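/- Let $G$ be a compact Lie group with Lie algebra $\mathfrak g$, let $\eta\in\mathfrak g^*$, let $G_\eta$ be the isotropy subgroup of $\eta$ under the coadjoint action $(g\cdot\nu)(A)=\nu(\mathrm{Ad}_{g^{-1}}A)$, with Lie algebra $\mathfrak g_\eta$, and let $\mathcal O=G\cdot\eta\cong G/G_\eta$ be the orbit, with the symplectic form $\omega_\nu(X_A(\nu),X_B(\nu))=\nu([A,B])$, where $X_A$ is the vector field on $\mathcal O$ generated by $A\in\mathfrak g$. Put $f_A(\nu)=-\nu(A)$, so that $\iota_{X_A}\omega=-df_A$. Assume that there is a character $\Lambda:G_\eta\to U(1)$ whose derivative is the functional $C\in\mathfrak g_\eta\mapsto 2\pi i\,\eta(C)$, and fix one. Let $L=G\times_\Lambda\mathbb C=(G\times\mathbb C)/\simeq$ with $(g,z)\simeq(gb^{-1},\Lambda(b)z)$ for $b\in G_\eta$, a line bundle over $\mathcal O$ with projection $\pi([g,z])=g\cdot\eta$. Let $D$ be the connection on $L$ whose connection form on $L^\times=L\setminus\{\text{zero section}\}$ pulls back along $G\times\mathbb C^\times\to L^\times$, $(g,z)\mapsto[g,z]$, to $\Omega_{(g,z)}=\theta_g+\frac{1}{2\pi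 i}\frac{dz}{z}$, where $\theta$ is the left invariant $1$-form on $G$ with value $\eta$ at $e$. That is, $(D_Y\sigma)(\pi(y))=Y^\sharp(\sigma^\sharp)\,y$ for $y\in L^\times$, where $Y^\sharp$ is the horizontal lift of $Y$ and $\sigma^\sharp:L^\times\to\mathbb C$ is given by $\sigma(\pi(y))=\sigma^\sharp(y)\,y$. For $A\in\mathfrak g$ let $$\mathcal P_A=-D_{X_A}-2\pi i f_A$$ acting on $C^\infty(L)$. Let $\mathcal E_\Lambda$ be the space of smooth functions $s:G\to\mathbb C$ with $s(gb^{-1})=\Lambda(b)s(g)$ for all $g\in G$, $b\in G_\eta$. Identify $C^\infty(L)$ with $\mathcal E_\Lambda$ by $\sigma\leftrightarrow s$, $\sigma(g\cdot\eta)=[g,s(g)]$, and transport $\mathcal P_A$ to $\mathcal E_\Lambda$ by this identification. Then $\mathcal P$ on $\mathcal E_\Lambda$ is the derivative of the action $\rho:G\times\mathcal E_\Lambda\to\mathcal E_\Lambda$, $\rho(b)s=s\circ\mathcal L_{b^{-1}}$, where $\mathcal L_c$ is left multiplication by $c$ in $G$. That is, for every $s\in\mathcal E_\Lambda$ one has $\mathcal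 P_A s\in\mathcal E_\Lambda$ for all $A\in\mathfrak g$, the function $(b,g)\mapsto(\rho(b)s)(g)$ is smooth on $G\times G$, and for all $A\in\mathfrak g$ and $g\in G$ the derivative of $b\mapsto(\rho(b)s)(g)$ at $b=e$ in the direction $A$ is $(\mathcal P_A s)(g)$; in particular $$\frac{d}{dt}\Big|_{t=0}(\rho(e^{tA})s)(g)=(\mathcal P_A s)(g).$$ Hence the prequantum data $(L,D)$ are $G$-invariant: there is a linear action $\rho$ of $G$ on $C^\infty(L)$ that generates $\mathcal P$, that is, for every $\sigma\in C^\infty(L)$ the sections $\rho(b)\sigma$ depend smoothly on $b\in G$, jointly with the point of $\mathcal O$, and the derivative of $b\mapsto\rho(b)\sigma$ at $b=e$ in the direction $A$ is, at each point of $\mathcal O$, equal to $\mathcal P_A\sigma$, for every $A\in\mathfrak g$. -/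

import Mathlib

open scoped Manifold ContDiff

noncomputable section

namespace CoadjointOrbit

section LieAlgebra

variable {E : Type*} [NormedAddCommGroup E] [NormedSpace ℝ E]
  {G : Type*} [TopologicalSpace G] [ChartedSpace E G] [Group G]

/-- The Lie algebra `𝔤 = T_1 G`. -/
abbrev LieAlg (E : Type*) [NormedAddCommGroup E] [NormedSpace ℝ E]
    (G : Type*) [TopologicalSpace G] [ChartedSpace E G] [Group G] : Type _ :=
  GroupLieAlgebra 𝓘(ℝ, E) G

/-- The dual `𝔤*`. The tangent space `T_1 G` of a Lie group modelled on `E` is by definition a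
copy of `E`, so `𝔤*` is the normed space of linear forms on `E`. -/
abbrev LieDual (E : Type*) [NormedAddCommGroup E] [NormedSpace ℝ E] : Type _ := E →L[ℝ] ℝ

/-- The adjoint action: `Ad_g` is the derivative at `1` of `x ↦ g x g⁻¹`. -/
def Ad (g : G) : E →L[ℝ] E :=
  mfderiv 𝓘(ℝ, E) 𝓘(ℝ, E) (fun x : G => g * x * g⁻¹) 1

variable [LieGroup 𝓘(ℝ, E) ∞ G]

theorem mdifferentiableAt_conj (g x : G) :
    MDifferentiableAt 𝓘(ℝ, E) 𝓘(ℝ, E) (fun x : G => g * x * g⁻¹) x := by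
  have h : ContMDiff 𝓘(ℝ, E) 𝓘(ℝ, E) ∞ (fun x : G => g * x * g⁻¹) :=
    (contMDiff_const.mul contMDiff_id).mul contMDiff_const
  exact h.mdifferentiableAt (by simp)

theorem Ad_one : Ad (E := E) (1 : G) = ContinuousLinearMap.id ℝ E := by
  have h : (fun x : G => 1 * x * (1 : G)⁻¹) = id := by ext x; simp
  unfold Ad
  rw [h]
  exact mfderiv_id

theorem Ad_mul (g h : G) : Ad (E := E) (g * h) = (Ad g).comp (Ad h) := by
  have e : (fun x : G => g * h * x * (g * h)⁻¹)
      = (fun x : G => g * x * g⁻¹) ∘ (fun x : G => h * x * h⁻¹) := by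
    ext x; simp [mul_assoc]
  unfold Ad
  rw [e, mfderiv_comp (I' := 𝓘(ℝ, E)) (1 : G) (mdifferentiableAt_conj g _)
    (mdifferentiableAt_conj h _)]
  have h1 : h * 1 * h⁻¹ = 1 := by simp
  rw [h1]
  rfl

/-- The coadjoint action `(g · ν)(A) = ν (Ad_{g⁻¹} A)`. -/
def coad (g : G) (ν : LieDual E) : LieDual E := ν.comp (Ad g⁻¹)

theorem coad_one (ν : LieDual E) : coad (1 : G) ν = ν := by
  simp [coad, Ad_one]

theorem coad_mul (g h : G) (ν : LieDual E) : coad (g * h) ν = coad g (coad h ν) := by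
  simp [coad, Ad_mul, ContinuousLinearMap.comp_assoc]

variable (G) in
/-- The isotropy subgroup `G_η` of `η` under the coadjoint action. -/
def isotropy (η : LieDual E) : Subgroup G where
  carrier := {g | coad g η = η}
  one_mem' := coad_one η
  mul_mem' {a b} ha hb := by
    simp only [Set.mem_ofPred_eq] at ha hb ⊢
    rw [coad_mul, hb, ha]
  inv_mem' {a} ha := by
    simp only [Set.mem_ofPred_eq] at ha ⊢
    conv_lhs => rw [← ha]
    rw [← coad_mul, inv_mul_cancel, coad_one]

variable (G) in
/-- The coadjoint orbit `𝒪 = G · η ⊆ 𝔤*`, i.e. `G ⧸ G_η` through `g G_η ↦ g · η`. -/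
def Orbit (η : LieDual E) : Type _ := {ν : LieDual E // ∃ g : G, coad g η = ν}

/-- The projection `G → 𝒪`, `g ↦ g · η`. -/
def orbitMap (η : LieDual E) (g : G) : Orbit G η := ⟨coad g η, g, rfl⟩

/-- The vector field on `𝔤*` generated by `A ∈ 𝔤`: `X_A(ν)` is the derivative of `b ↦ b · ν` at
`b = 1` in the direction `A`. -/
def fundamentalField (A : LieAlg E G) (ν : LieDual E) : LieDual E :=
  mfderiv 𝓘(ℝ, E) 𝓘(ℝ, LieDual E) (fun b : G => coad b ν) 1 A

/-- The Hamiltonian `f_A(ν) = -ν(A)` on the orbit, with `ι_{X_A} ω = -d f_A` for the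
symplectic form `ω_ν(X_A(ν), X_B(ν)) = ν([A, B])`. -/
def hamiltonian {η : LieDual E} (A : LieAlg E G) (ν : Orbit G η) : ℝ := -(ν.1 A)

/-- The derivative of the character `Λ` of `G_η` is the functional `C ↦ 2πi η(C)` on `𝔤_η`:
along each smooth one-parameter subgroup `γ` of `G` that lies in `G_η`, the derivative of
`Λ ∘ γ` at `0` is `2πi η(γ'(0))`. -/
def HasDifferential (η : LieDual E) (Λ : isotropy G η →* Circle) : Prop :=
  ∀ (γ : ℝ → G) (hγ : ∀ t, γ t ∈ isotropy G η) (C : LieAlg E G),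
    (∀ t u, γ (t + u) = γ t * γ u) →
    ContMDiff 𝓘(ℝ, ℝ) 𝓘(ℝ, E) ∞ γ →
    (mfderiv 𝓘(ℝ, ℝ) 𝓘(ℝ, E) γ 0 (1 : ℝ) : E) = C →
    HasDerivAt (fun t : ℝ => (Λ ⟨γ t, hγ t⟩ : ℂ)) (2 * Real.pi * Complex.I * (η C : ℝ)) 0

end LieAlgebra

section Bundle

variable {E : Type*} [NormedAddCommGroup E] [NormedSpace ℝ E]
  {G : Type*} [TopologicalSpace G] [ChartedSpace E G] [Group G] [LieGroup 𝓘(ℝ, E) ∞ G]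
  {η : LieDual E} (Λ : isotropy G η →* Circle)

/-- The relation `(g, z) ≃ (g b⁻¹, Λ(b) z)`, `b ∈ G_η`, on `G × ℂ`. -/
def bundleSetoid : Setoid (G × ℂ) where
  r p q := ∃ b : isotropy G η, q.1 = p.1 * (b : G)⁻¹ ∧ q.2 = (Λ b : ℂ) * p.2
  iseqv :=
    { refl := fun p => ⟨1, by simp, by simp⟩
      symm := by
        rintro ⟨g, z⟩ ⟨g', z'⟩ ⟨b, h1, h2⟩
        refine ⟨b⁻¹, ?_, ?_⟩
        · simp_all
        · simp_all
      trans := by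
        rintro ⟨g, z⟩ ⟨g', z'⟩ ⟨g'', z''⟩ ⟨b, h1, h2⟩ ⟨c, h3, h4⟩
        refine ⟨c * b, ?_, ?_⟩
        · simp_all [mul_assoc]
        · simp_all [mul_assoc] }

/-- The total space of the prequantum line bundle `L = G ×_Λ ℂ`. -/
def Total : Type _ := Quotient (bundleSetoid Λ)

/-- The class `[g, z] ∈ L`. -/
def cls (g : G) (z : ℂ) : Total Λ := Quotient.mk (bundleSetoid Λ) (g, z)

/-- The bundle projection `π : L → 𝒪`, `[g, z] ↦ g · η`. -/
def proj : Total Λ → Orbit G η :=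
  Quotient.lift (fun p => orbitMap η p.1) (by
    rintro ⟨g, z⟩ ⟨g', z'⟩ ⟨b, h1, h2⟩
    have hb : coad ((b : G)⁻¹) η = η := (isotropy G η).inv_mem b.2
    simp only at h1
    subst h1
    exact Subtype.ext (by simp only [orbitMap, coad_mul, hb]))

/-- The fibre `L_ν` over a point `ν` of the orbit. -/
def Fiber (ν : Orbit G η) : Type _ := {y : Total Λ // proj Λ y = ν}

/-- `[g, z]` as a point of the fibre over `ν = g · η`. -/
def fiberCls {ν : Orbit G η} (g : G) (hg : orbitMap η g = ν) (z : ℂ) : Fiber Λ ν :=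
  ⟨cls Λ g z, hg⟩

theorem fiberCls_bijective {ν : Orbit G η} (g : G) (hg : orbitMap η g = ν) :
    Function.Bijective (fiberCls Λ g hg) := by
  constructor
  · intro z w h
    have h' : cls Λ g z = cls Λ g w := congrArg Subtype.val h
    obtain ⟨b, h1, h2⟩ := Quotient.exact h'
    have hb : b = 1 := by
      apply Subtype.ext
      simpa using h1
    subst hb
    simpa using h2.symm
  · rintro ⟨y, hy⟩
    induction y using Quotient.inductionOn with
    | h p =>
      obtain ⟨g', z⟩ := p
      have e : coad g' η = coad g η := congrArg Subtype.val (hy.trans hg.symm)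
      have hb : g⁻¹ * g' ∈ isotropy G η := by
        change coad (g⁻¹ * g') η = η
        rw [coad_mul, e, ← coad_mul, inv_mul_cancel, coad_one]
      refine ⟨(Λ ⟨_, hb⟩ : ℂ) * z, Subtype.ext ?_⟩
      refine (Quotient.sound ?_ : (Quotient.mk (bundleSetoid Λ) (g', z)) = _).symm
      exact ⟨⟨_, hb⟩, by simp, rfl⟩

/-- The identification `ℂ ≃ L_ν`, `z ↦ [g, z]`, for `ν = g · η`. -/
def frame {ν : Orbit G η} (g : G) (hg : orbitMap η g = ν) : ℂ ≃ Fiber Λ ν :=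
  Equiv.ofBijective _ (fiberCls_bijective Λ g hg)

/-- Some `g` with `g · η = ν`. -/
def base (ν : Orbit G η) : G := ν.2.choose

theorem orbitMap_base (ν : Orbit G η) : orbitMap η (base ν) = ν := Subtype.ext ν.2.choose_spec

instance (ν : Orbit G η) : AddCommGroup (Fiber Λ ν) :=
  (frame Λ (base ν) (orbitMap_base ν)).symm.addCommGroup

instance (ν : Orbit G η) : Module ℂ (Fiber Λ ν) :=
  (frame Λ (base ν) (orbitMap_base ν)).symm.module ℂ

theorem frame_change {ν : Orbit G η} (g g' : G) (hg : orbitMap η g = ν)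
    (hg' : orbitMap η g' = ν) : ∃ c : ℂ, ∀ z, frame Λ g hg z = frame Λ g' hg' (c * z) := by
  have e : coad g η = coad g' η := congrArg Subtype.val (hg.trans hg'.symm)
  have hb : g'⁻¹ * g ∈ isotropy G η := by
    change coad (g'⁻¹ * g) η = η
    rw [coad_mul, e, ← coad_mul, inv_mul_cancel, coad_one]
  refine ⟨(Λ ⟨_, hb⟩ : ℂ), fun z => Subtype.ext (Quotient.sound ?_)⟩
  exact ⟨⟨_, hb⟩, by simp, rfl⟩

/-- The vector space structure of the fibre does not depend on the chosen representative:
`[g, z] + [g, w] = [g, z + w]`. -/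
theorem frame_add {ν : Orbit G η} (g : G) (hg : orbitMap η g = ν) (z w : ℂ) :
    frame Λ g hg (z + w) = frame Λ g hg z + frame Λ g hg w := by
  obtain ⟨c, hc⟩ := frame_change Λ g (base ν) hg (orbitMap_base ν)
  rw [hc, hc, hc, Equiv.add_def]
  simp [mul_add]

/-- `a • [g, z] = [g, a z]`. -/
theorem frame_smul {ν : Orbit G η} (g : G) (hg : orbitMap η g = ν) (a z : ℂ) :
    frame Λ g hg (a * z) = a • frame Λ g hg z := by
  obtain ⟨c, hc⟩ := frame_change Λ g (base ν) hg (orbitMap_base ν)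
  rw [hc, hc, Equiv.smul_def]
  simp [mul_left_comm]

/-- The identification `z ↦ [g, z]` is linear. -/
def frameₗ {ν : Orbit G η} (g : G) (hg : orbitMap η g = ν) : ℂ ≃ₗ[ℂ] Fiber Λ ν :=
  { frame Λ g hg with
    map_add' := frame_add Λ g hg
    map_smul' := frame_smul Λ g hg }

/-- All (set-theoretic) sections of `L`. -/
abbrev AllSections : Type _ := (ν : Orbit G η) → Fiber Λ ν

/-- The function `s : G → ℂ` of a section `σ`, given by `σ(g G_η) = [g, s(g)]`. -/
def funOfSection : AllSections Λ →ₗ[ℂ] (G → ℂ) where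
  toFun σ g := (frameₗ Λ g rfl).symm (σ (orbitMap η g))
  map_add' σ τ := by ext g; simp
  map_smul' a σ := by ext g; simp

/-- The defining relation `σ(g G_η) = [g, s(g)]`. -/
theorem section_eq (σ : AllSections Λ) (g : G) :
    (σ (orbitMap η g)).1 = cls Λ g (funOfSection Λ σ g) :=
  congrArg Subtype.val ((frameₗ Λ g rfl).apply_symm_apply (σ (orbitMap η g))).symm

theorem cls_inj (g : G) {z w : ℂ} (h : cls Λ g z = cls Λ g w) : z = w :=
  (fiberCls_bijective Λ g rfl).1 (Subtype.ext h)

theorem cls_mul_inv (g : G) (b : isotropy G η) (z : ℂ) :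
    cls Λ (g * (b : G)⁻¹) ((Λ b : ℂ) * z) = cls Λ g z :=
  (Quotient.sound ⟨b, rfl, rfl⟩ : Quotient.mk (bundleSetoid Λ) (g, z) = _).symm

theorem orbitMap_mul_inv (g : G) (b : isotropy G η) :
    orbitMap η (g * (b : G)⁻¹) = orbitMap η g := by
  have hb : coad ((b : G)⁻¹) η = η := (isotropy G η).inv_mem b.2
  exact Subtype.ext (by simp only [orbitMap, coad_mul, hb])

theorem funOfSection_equivariant (σ : AllSections Λ) (g : G) (b : isotropy G η) :
    funOfSection Λ σ (g * (b : G)⁻¹) = (Λ b : ℂ) * funOfSection Λ σ g := by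
  apply cls_inj Λ (g * (b : G)⁻¹)
  rw [cls_mul_inv, ← section_eq, ← section_eq, orbitMap_mul_inv]

/-- The space `C^∞(L)` of smooth sections. The smooth structures of `𝒪 = G ⧸ G_η` and of
`L = (G × ℂ) ⧸ ≃` are the quotient ones; a section is smooth iff its pull-back to `G`, a section
of the trivialised bundle `G × ℂ`, is smooth. -/
def SmoothSections : Submodule ℂ (AllSections Λ) where
  carrier := {σ | ContMDiff 𝓘(ℝ, E) 𝓘(ℝ, ℂ) ∞ (funOfSection Λ σ)}
  zero_mem' := by
    simp only [Set.mem_ofPred_eq, map_zero]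
    exact contMDiff_const
  add_mem' {σ τ} hσ hτ := by
    simp only [Set.mem_ofPred_eq, map_add] at *
    exact hσ.add hτ
  smul_mem' a σ hσ := by
    simp only [Set.mem_ofPred_eq, map_smul] at *
    exact (contDiff_const_smul a).contMDiff.comp hσ

/-- The space `ℰ_Λ` of smooth `Λ`-equivariant functions on `G`: `s(g b⁻¹) = Λ(b) s(g)`. -/
def EquivariantFunctions : Submodule ℂ (G → ℂ) where
  carrier := {s | ContMDiff 𝓘(ℝ, E) 𝓘(ℝ, ℂ) ∞ s ∧
    ∀ (g : G) (b : isotropy G η), s (g * (b : G)⁻¹) = (Λ b : ℂ) * s g}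
  zero_mem' := ⟨contMDiff_const, by simp⟩
  add_mem' {s t} hs ht := ⟨hs.1.add ht.1, fun g b => by simp [hs.2, ht.2, mul_add]⟩
  smul_mem' a s hs := ⟨(contDiff_const_smul a).contMDiff.comp hs.1, fun g b => by simp [hs.2, mul_left_comm]⟩

theorem exists_section (s : G → ℂ)
    (hs : ∀ (g : G) (b : isotropy G η), s (g * (b : G)⁻¹) = (Λ b : ℂ) * s g) :
    ∃ σ : AllSections Λ, funOfSection Λ σ = s := by
  refine ⟨fun ν => frame Λ (base ν) (orbitMap_base ν) (s (base ν)), ?_⟩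
  ext g
  apply cls_inj Λ g
  rw [← section_eq]
  change cls Λ (base (orbitMap η g)) (s (base (orbitMap η g))) = cls Λ g (s g)
  have e : coad (base (orbitMap η g)) η = coad g η :=
    congrArg Subtype.val (orbitMap_base (orbitMap η g))
  have hb : (base (orbitMap η g))⁻¹ * g ∈ isotropy G η := by
    change coad _ η = η
    rw [coad_mul, ← e, ← coad_mul, inv_mul_cancel, coad_one]
  have h1 : g * ((⟨_, hb⟩ : isotropy G η) : G)⁻¹ = base (orbitMap η g) := by simp
  rw [← h1, hs, cls_mul_inv]

/-- The identification `C^∞(L) ≃ ℰ_Λ`, `σ ↦ s`. -/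
def sectionEquiv : SmoothSections Λ ≃ₗ[ℂ] EquivariantFunctions Λ :=
  LinearEquiv.ofBijective
    ((funOfSection Λ).restrict (p := SmoothSections Λ) (q := EquivariantFunctions Λ)
      (fun σ hσ => ⟨hσ, funOfSection_equivariant Λ σ⟩))
    ⟨by
      intro σ τ h
      have h' : funOfSection Λ σ.1 = funOfSection Λ τ.1 := congrArg Subtype.val h
      apply Subtype.ext
      funext ν
      obtain ⟨g, hg⟩ := ν.2
      obtain rfl : orbitMap η g = ν := Subtype.ext hg
      apply Subtype.ext
      rw [section_eq, section_eq, h'],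
    by
      rintro ⟨s, hs⟩
      obtain ⟨σ, hσ⟩ := exists_section Λ s hs.2
      refine ⟨⟨σ, ?_⟩, Subtype.ext hσ⟩
      change ContMDiff 𝓘(ℝ, E) 𝓘(ℝ, ℂ) ∞ (funOfSection Λ σ)
      rw [hσ]
      exact hs.1⟩

end Bundle

section Connection

variable {E : Type*} [NormedAddCommGroup E] [NormedSpace ℝ E]
  {G : Type*} [TopologicalSpace G] [ChartedSpace E G] [Group G] [LieGroup 𝓘(ℝ, E) ∞ G]

/-- The left invariant `1`-form `θ` on `G` with value `η` at `1`. -/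
def leftInvariantForm (η : LieDual E) (g : G) (v : TangentSpace 𝓘(ℝ, E) g) : ℝ :=
  η (mfderiv 𝓘(ℝ, E) 𝓘(ℝ, E) (fun x : G => g⁻¹ * x) g v)

/-- The connection form `Ω = (θ, d)` of `L^×`, pulled back along `G × ℂ^× → L^×`,
`(g, z) ↦ [g, z]`; here `d` is `(2πi)⁻¹` times the invariant form `dz / z` of `ℂ^×`. -/
def connectionForm (η : LieDual E) (g : G) (z : ℂ) (v : TangentSpace 𝓘(ℝ, E) g) (ζ : ℂ) : ℂ :=
  (leftInvariantForm η g v : ℂ) + (2 * Real.pi * Complex.I)⁻¹ * (ζ / z)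

/-- The tangent vector `(v, ζ)` to `G × ℂ^×` at `(g, z)` represents the horizontal lift to
`[g, z] ∈ L^×` of the tangent vector `Y ∈ T_{g · η} 𝒪 ⊆ 𝔤*`. -/
def IsHorizontalLift (η : LieDual E) (Y : LieDual E) (g : G) (z : ℂ)
    (v : TangentSpace 𝓘(ℝ, E) g) (ζ : ℂ) : Prop :=
  (mfderiv 𝓘(ℝ, E) 𝓘(ℝ, LieDual E) (fun x : G => coad x η) g v : LieDual E) = Y ∧
    connectionForm η g z v ζ = 0

variable {η : LieDual E} (Λ : isotropy G η →* Circle)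

/-- The lift `σ♯ : L^× → ℂ` of a section, `σ(π(y)) = σ♯(y) y`, read on `G × ℂ^×`. -/
def sharp (σ : AllSections Λ) (p : G × ℂ) : ℂ := funOfSection Λ σ p.1 / p.2

/-- The defining relation `σ(π(y)) = σ♯(y) y` for `y = [g, z]`, `z ≠ 0`. -/
theorem sharp_spec (σ : AllSections Λ) (g : G) (z : ℂ) (hz : z ≠ 0) :
    σ (orbitMap η g) = sharp Λ σ (g, z) • frame Λ g rfl z := by
  rw [← frame_smul]
  apply Subtype.ext
  rw [section_eq]
  change _ = cls Λ g (funOfSection Λ σ g / z * z)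
  rw [div_mul_cancel₀ _ hz]

/-- The derivative of `σ♯` at `(g, z)` in the direction `(v, ζ)`. -/
def sharpDeriv (σ : AllSections Λ) (g : G) (z : ℂ) (v : TangentSpace 𝓘(ℝ, E) g) (ζ : ℂ) : ℂ :=
  mfderiv (𝓘(ℝ, E).prod 𝓘(ℝ, ℂ)) 𝓘(ℝ, ℂ) (sharp Λ σ) (g, z) (v, ζ)

/-- `w ∈ L_ν` is a value of the covariant derivative `D_Y σ` at `ν`: for some `y = [g, z] ∈ L^×`
over `ν` and some representative of the horizontal lift `Y♯` of `Y` to `y`, one has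
`w = Y♯(σ♯) y`. (For smooth `σ` and `Y` tangent to the orbit, there is exactly one such `w`.) -/
def IsCovariantDerivative (σ : AllSections Λ) (ν : Orbit G η) (Y : LieDual E)
    (w : Fiber Λ ν) : Prop :=
  ∃ (g : G) (hg : orbitMap η g = ν) (z : ℂ) (v : TangentSpace 𝓘(ℝ, E) g) (ζ : ℂ),
    z ≠ 0 ∧ IsHorizontalLift η Y g z v ζ ∧
    w = sharpDeriv Λ σ g z v ζ • frame Λ g hg z

/-- The covariant derivative `D_Y σ` at `ν` for a tangent vector `Y` to the orbit at `ν`. -/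
def covariantDerivative (σ : AllSections Λ) (ν : Orbit G η) (Y : LieDual E) : Fiber Λ ν :=
  Classical.epsilon (IsCovariantDerivative Λ σ ν Y)

/-- The prequantization operator `𝒫_A = -D_{X_A} - 2πi f_A` on sections of `L`. -/
def prequantumOp (A : LieAlg E G) (σ : AllSections Λ) : AllSections Λ := fun ν =>
  -covariantDerivative Λ σ ν (fundamentalField A ν.1)
    - (2 * Real.pi * Complex.I * (hamiltonian A ν : ℂ)) • σ ν

/-- The operator `𝒫_A` translated to `ℰ_Λ` by the identification `C^∞(L) ≃ ℰ_Λ`. -/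
def prequantumOpFun (A : LieAlg E G) (s : EquivariantFunctions Λ) : G → ℂ :=
  funOfSection Λ (prequantumOp Λ A ((sectionEquiv Λ).symm s).1)

/-- The action `ρ(b) s = s ∘ 𝓛_{b⁻¹}` of `G` on `ℰ_Λ`. -/
def leftTranslation : Representation ℂ G (EquivariantFunctions Λ) where
  toFun b :=
    { toFun := fun s => ⟨fun g => s.1 (b⁻¹ * g),
        s.2.1.comp (contMDiff_const.mul contMDiff_id),
        fun g c => by
          have h := s.2.2 (b⁻¹ * g) c
          rwa [mul_assoc] at h⟩
      map_add' := fun _ _ => rfl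
      map_smul' := fun _ _ => rfl }
  map_one' := by
    ext s
    simp
  map_mul' a b := by
    ext s
    simp [mul_assoc]

/-- A linear action `ρ` of `G` on `C^∞(L)` generates `𝒫`: for each `σ`, the sections `ρ(b) σ`
depend smoothly on `b`, and at each point of the orbit the derivative of `b ↦ ρ(b) σ` at `b = 1`
in each direction `A ∈ 𝔤` is `𝒫_A σ`. Sections are read in the identification `z ↦ [g, z]` of `ℂ`
with the fibre over `g · η`. -/
def Generates (ρ : Representation ℂ G (SmoothSections Λ)) : Prop :=
  ∀ σ : SmoothSections Λ,
    ContMDiff (𝓘(ℝ, E).prod 𝓘(ℝ, E)) 𝓘(ℝ, ℂ) ∞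
      (fun p : G × G => funOfSection Λ (ρ p.1 σ).1 p.2) ∧
    ∀ (A : LieAlg E G) (g : G),
      (mfderiv 𝓘(ℝ, E) 𝓘(ℝ, ℂ) (fun b : G => funOfSection Λ (ρ b σ).1 g) 1 A : ℂ)
        = funOfSection Λ (prequantumOp Λ A σ.1) g

/-- The prequantum data `(L, D)` are `G`-invariant: some action of `G` on `C^∞(L)`
generates `𝒫`. -/
def IsGInvariant : Prop := ∃ ρ : Representation ℂ G (SmoothSections Λ), Generates Λ ρ

end Connection

end CoadjointOrbit

end

/-! Write a section as an equivariant function s on G. The right translate v = A·g lifts X_A through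
G → 𝒪 (`mfderiv_coad_rightTranslate`), and θ(v) = (g·η)(A) = -f_A
(`leftInvariantForm_rightTranslate`). Horizontality forces ζ = -2πi θ(v) z, so the quotient rule for
σ♯ = s/z turns D_{X_A} into ds(v) + 2πi θ(v) s. In 𝒫_A the second term cancels against -2πi f_A,
leaving -ds(A·g), which is the derivative of b ↦ s(b⁻¹g) at b = 1.

The substance lies in independence of the lift, since D is defined by choosing among all horizontal
lifts (`isCovariantDerivative_eq`). Two lifts at one g differ by a vector v tangent to the fibre, so
ds(v) = -2πi θ(v) s is required: `differential_of_tangent_fibre`, the one place where the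
differential of Λ enters. That differential is known along one-parameter subgroups, so g⁻¹v is first
integrated to one, which then stays in G_η (`oneParameterSubgroup_mem_isotropy`). Change of g within
the fibre is absorbed by equivariance (`frame_mul_inv`). -/

noncomputable section

namespace CoadjointOrbit

/-! ### One-parameter subgroups as integral curves of left invariant fields. -/

section OneParameterSubgroup

variable {E : Type*} [NormedAddCommGroup E] [NormedSpace ℝ E]
  {G : Type*} [TopologicalSpace G] [ChartedSpace E G]

theorem hasDerivAt_comp_curve {F : Type*} [NormedAddCommGroup F] [NormedSpace ℝ F]
    {f : G → F} {c : ℝ → G} {t : ℝ} {x : G} {v : E} (hx : c t = x)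
    (hf : MDifferentiableAt 𝓘(ℝ, E) 𝓘(ℝ, F) f x)
    (hc : MDifferentiableAt 𝓘(ℝ, ℝ) 𝓘(ℝ, E) c t)
    (hv : (mfderiv 𝓘(ℝ, ℝ) 𝓘(ℝ, E) c t (1 : ℝ) : E) = v) :
    HasDerivAt (fun u => f (c u)) (mfderiv 𝓘(ℝ, E) 𝓘(ℝ, F) f x v : F) t := by
  subst hx hv
  have h : HasFDerivAt (f ∘ c) ((mfderiv 𝓘(ℝ, E) 𝓘(ℝ, F) f (c t) : E →L[ℝ] F).comp
      (mfderiv 𝓘(ℝ, ℝ) 𝓘(ℝ, E) c t : ℝ →L[ℝ] E)) t :=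
    (hf.hasMFDerivAt.comp t hc.hasMFDerivAt).hasFDerivAt
  exact hasDerivAt_iff_hasFDerivAt.2 (h.congr_fderiv (ContinuousLinearMap.ext_ring
    (one_smul ℝ (mfderiv 𝓘(ℝ, E) 𝓘(ℝ, F) f (c t)
      (mfderiv 𝓘(ℝ, ℝ) 𝓘(ℝ, E) c t (1 : ℝ)) : F)).symm))

variable [Group G]

theorem mulInvariantVectorField_one (v : LieAlg E G) :
    mulInvariantVectorField (I := 𝓘(ℝ, E)) v (1 : G) = v := by
  have h : (fun x : G => 1 * x) = id := by ext x; simp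
  unfold mulInvariantVectorField
  rw [h, mfderiv_id]
  rfl

variable [LieGroup 𝓘(ℝ, E) ∞ G]

/-- The field is the tangent map of multiplication applied to the pair (0_g, v) over (g, 1), hence a
composite of smooth maps. -/
theorem contMDiff_leftInvariantField (v : LieAlg E G) :
    ContMDiff 𝓘(ℝ, E) 𝓘(ℝ, E).tangent ∞
      (fun g : G => (⟨g, mulInvariantVectorField v g⟩ : TangentBundle 𝓘(ℝ, E) G)) := by
  have : IsManifold 𝓘(ℝ, E) (∞ + 1) G := inferInstanceAs (IsManifold 𝓘(ℝ, E) ∞ G)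
  let fg : G → TangentBundle 𝓘(ℝ, E) G := fun g ↦ ⟨g, 0⟩
  have sfg : ContMDiff 𝓘(ℝ, E) 𝓘(ℝ, E).tangent ∞ fg := Bundle.contMDiff_zeroSection _ _
  let fv : G → TangentBundle 𝓘(ℝ, E) G := fun _ ↦ ⟨1, v⟩
  have sfv : ContMDiff 𝓘(ℝ, E) 𝓘(ℝ, E).tangent ∞ fv := contMDiff_const
  have S₂ := contMDiff_equivTangentBundleProd_symm (n := ∞) (I := 𝓘(ℝ, E)) (M := G)
    (I' := 𝓘(ℝ, E)) (M' := G)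
  have S₃ : ContMDiff (𝓘(ℝ, E).prod 𝓘(ℝ, E)).tangent 𝓘(ℝ, E).tangent ∞
      (tangentMap (𝓘(ℝ, E).prod 𝓘(ℝ, E)) 𝓘(ℝ, E) (fun (p : G × G) ↦ p.1 * p.2)) :=
    ContMDiff.contMDiff_tangentMap (n := ∞) (contMDiff_mul 𝓘(ℝ, E) ∞) (m := ∞) le_rfl
  have S := (S₃.comp S₂).comp (sfg.prodMk sfv)
  convert! S with g
  · simp [fg, fv]
  · have h := mfderiv_prod_eq_add_apply (I'' := 𝓘(ℝ, E)) (v := ((0, v) : E × E))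
      ((contMDiff_mul 𝓘(ℝ, E) ∞ (G := G)).mdifferentiableAt (x := (g, 1)) (by simp))
    refine Eq.trans ?_ h.symm
    exact ((congrArg (· + _) (map_zero _)).trans (zero_add _)).symm

theorem mdifferentiable_mul_left (g : G) :
    MDifferentiable 𝓘(ℝ, E) 𝓘(ℝ, E) (fun x : G => g * x) :=
  (contMDiff_const.mul contMDiff_id : ContMDiff 𝓘(ℝ, E) 𝓘(ℝ, E) ∞ _).mdifferentiable (by simp)

theorem mdifferentiable_mul_right (g : G) :
    MDifferentiable 𝓘(ℝ, E) 𝓘(ℝ, E) (fun x : G => x * g) :=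
  (contMDiff_id.mul contMDiff_const : ContMDiff 𝓘(ℝ, E) 𝓘(ℝ, E) ∞ _).mdifferentiable (by simp)

theorem mfderiv_mul_left_leftInvariantField (g h : G) (v : LieAlg E G) :
    (mfderiv 𝓘(ℝ, E) 𝓘(ℝ, E) (fun x : G => g * x) h
      (mulInvariantVectorField (I := 𝓘(ℝ, E)) v h) : E)
      = mulInvariantVectorField (I := 𝓘(ℝ, E)) v (g * h) := by
  have e : (fun x : G => g * h * x) = (fun x => g * x) ∘ (fun x => h * x) := by
    ext x; simp [mul_assoc]
  have h1 := mfderiv_comp_apply_of_eq (I := 𝓘(ℝ, E)) (I' := 𝓘(ℝ, E)) (I'' := 𝓘(ℝ, E))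
    (x := (1 : G)) (y := h)
    (mdifferentiable_mul_left (E := E) g h) (mdifferentiable_mul_left (E := E) h 1) (mul_one h) v
  rw [← e] at h1
  exact h1.symm

theorem isMIntegralCurveOn_mul_left {v : LieAlg E G} {γ : ℝ → G} {s : Set ℝ}
    (hγ : IsMIntegralCurveOn γ (mulInvariantVectorField (I := 𝓘(ℝ, E)) v) s) (g : G) :
    IsMIntegralCurveOn (fun t => g * γ t) (mulInvariantVectorField (I := 𝓘(ℝ, E)) v) s := by
  intro t ht
  refine ((mdifferentiable_mul_left (E := E) g (γ t)).hasMFDerivAt.comp_hasMFDerivWithinAt t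
    (hγ t ht)).congr_mfderiv ?_
  refine ContinuousLinearMap.ext fun a => ?_
  refine (ContinuousLinearMap.map_smul _ _ _).trans ?_
  exact congrArg (fun w : E => (show ℝ from a) • w) (mfderiv_mul_left_leftInvariantField g (γ t) v)

/-- Bootstrapping: in a chart the curve solves c' = F(c) with F smooth, so C^n regularity of c gives
C^n regularity of c', and thus C^(n+1) of c. -/
theorem contMDiff_integralCurve {v : LieAlg E G} {γ : ℝ → G}
    (hγ : IsMIntegralCurve γ (mulInvariantVectorField (I := 𝓘(ℝ, E)) v)) :
    ContMDiff 𝓘(ℝ, ℝ) 𝓘(ℝ, E) ∞ γ := by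
  have : IsManifold 𝓘(ℝ, E) 1 G := IsManifold.of_le (n := ∞) (by norm_cast)
  intro t₀
  set φ := extChartAt 𝓘(ℝ, E) (γ t₀) with hφ
  -- The field in the coordinates of the chart at `γ t₀`; its smoothness is that of a section read
  -- in a trivialization.
  let F : G → E := fun x => tangentCoordChange 𝓘(ℝ, E) x (γ t₀) x
    (mulInvariantVectorField (I := 𝓘(ℝ, E)) v x)
  have hF : ContMDiffOn 𝓘(ℝ, E) 𝓘(ℝ, E) ∞ F φ.source := by
    have : IsManifold 𝓘(ℝ, E) (∞ + 1) G := inferInstanceAs (IsManifold 𝓘(ℝ, E) ∞ G)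
    let e := trivializationAt E (TangentSpace 𝓘(ℝ, E) : G → Type _) (γ t₀)
    have hs : φ.source ⊆ e.baseSet := by
      rw [hφ, extChartAt_source]
      exact subset_rfl
    exact (e.contMDiffOn_section_iff (isOpen_extChartAt_source _) hs).1
      (contMDiff_leftInvariantField v).contMDiffOn
  have hd : ∀ t, γ t ∈ φ.source → HasDerivAt (φ ∘ γ) (F (γ t)) t := fun t ht =>
    ((hγ.isMIntegralCurveOn Set.univ).hasDerivWithinAt (Set.mem_univ t) ht).hasDerivAt
      Filter.univ_mem
  have hU : IsOpen (γ ⁻¹' φ.source) := (isOpen_extChartAt_source _).preimage hγ.continuous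
  have hFφ : ContDiffOn ℝ ∞ (F ∘ φ.symm) φ.target :=
    (hF.comp (contMDiffOn_extChartAt_symm (γ t₀)) φ.mapsTo_symm).contDiffOn
  have key : ∀ n : ℕ, ContDiffOn ℝ n (φ ∘ γ) (γ ⁻¹' φ.source) := by
    intro n
    induction n with
    | zero =>
      exact contDiffOn_zero.2 fun t ht => (hd t ht).continuousAt.continuousWithinAt
    | succ n ih =>
      rw [Nat.cast_succ, contDiffOn_succ_iff_deriv_of_isOpen hU]
      refine ⟨fun t ht => (hd t ht).differentiableAt.differentiableWithinAt, by simp, ?_⟩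
      refine ((hFφ.of_le (by exact_mod_cast le_top)).comp ih
        fun t ht => φ.map_source ht).congr fun t ht => ?_
      simp [(hd t ht).deriv, φ.left_inv ht]
  have h1 : ContMDiffOn 𝓘(ℝ, ℝ) 𝓘(ℝ, E) ∞ (φ.symm ∘ φ ∘ γ) (γ ⁻¹' φ.source) :=
    (contMDiffOn_extChartAt_symm (γ t₀)).comp (contDiffOn_infty.2 key).contMDiffOn
      fun t ht => φ.map_source ht
  exact (h1.congr fun t ht => (φ.left_inv ht).symm).contMDiffAt
    (hU.mem_nhds (mem_extChartAt_source _))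

variable [T2Space G] [CompleteSpace E]

/-- Left translates of one local curve through 1 give curves through all points on a common time
interval, and a uniform existence time implies completeness. Multiplicativity is uniqueness: u ↦ γ(t
+ u) and u ↦ γ(t)γ(u) are integral curves that agree at 0. -/
theorem exists_global_integralCurve (v : LieAlg E G) :
    ∃ γ : ℝ → G, γ 0 = 1 ∧ IsMIntegralCurve γ (mulInvariantVectorField (I := 𝓘(ℝ, E)) v) ∧
      ∀ t u, γ (t + u) = γ t * γ u := by
  have : LieGroup 𝓘(ℝ, E) 1 G := LieGroup.of_le (n := ∞) (by norm_cast)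
  have : IsManifold 𝓘(ℝ, E) 1 G := inferInstance
  have hv := (contMDiff_leftInvariantField v).of_le (show (1 : WithTop ℕ∞) ≤ ∞ by norm_cast)
  obtain ⟨γ, h1, h2⟩ := exists_isMIntegralCurveAt_of_contMDiffAt_boundaryless 0 (hv 1)
  obtain ⟨ε, hε, h3⟩ := isMIntegralCurveAt_iff'.1 h2
  rw [Real.ball_eq_Ioo, zero_sub, zero_add] at h3
  obtain ⟨γ, h0, hγ⟩ := exists_isMIntegralCurve_of_isMIntegralCurveOn hv hε
    (fun x => ⟨fun t => x * γ t, by simp [h1], isMIntegralCurveOn_mul_left h3 x⟩) 1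
  refine ⟨γ, h0, hγ, fun t u => ?_⟩
  have h4 : IsMIntegralCurve (fun u => γ t * γ u) (mulInvariantVectorField (I := 𝓘(ℝ, E)) v) := by
    rw [isMIntegralCurve_iff_isMIntegralCurveOn] at hγ ⊢
    exact isMIntegralCurveOn_mul_left hγ _
  have h5 := isMIntegralCurve_Ioo_eq_of_contMDiff_boundaryless (t₀ := 0) hv (hγ.comp_add t) h4
    (by simp [h0])
  rw [add_comm]
  exact congrFun h5 u

/-- Every element of the Lie algebra is the velocity of a smooth one-parameter subgroup. -/
theorem exists_oneParameterSubgroup (v : LieAlg E G) :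
    ∃ γ : ℝ → G, (∀ t u, γ (t + u) = γ t * γ u) ∧ ContMDiff 𝓘(ℝ, ℝ) 𝓘(ℝ, E) ∞ γ ∧
      (mfderiv 𝓘(ℝ, ℝ) 𝓘(ℝ, E) γ 0 (1 : ℝ) : E) = v := by
  obtain ⟨γ, h0, hγ, hmul⟩ := exists_global_integralCurve v
  refine ⟨γ, hmul, contMDiff_integralCurve hγ, ?_⟩
  rw [(hγ 0).mfderiv]
  refine (one_smul ℝ (mulInvariantVectorField (I := 𝓘(ℝ, E)) v (γ 0) : E)).trans ?_
  rw [h0]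
  exact mulInvariantVectorField_one v

end OneParameterSubgroup

/-! ### Smooth dependence of derivatives, right translates, and curves in the isotropy group. -/

section Smoothness

variable {E : Type*} [NormedAddCommGroup E] [NormedSpace ℝ E]
  {G : Type*} [TopologicalSpace G] [ChartedSpace E G]

/-- With constant base points the coordinate changes go from a chart to itself and are trivial, so
smoothness in tangent coordinates is smoothness into a fixed space of linear maps. -/
theorem inTangentCoordinates_of_forall_eq [IsManifold 𝓘(ℝ, E) 1 G]
    {E' : Type*} [NormedAddCommGroup E'] [NormedSpace ℝ E']
    {M : Type*} [TopologicalSpace M] [ChartedSpace E' M] [IsManifold 𝓘(ℝ, E') 1 M]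
    {N : Type*} {f : N → G} {g : N → M} {y : G} {z : M} (hf : ∀ x, f x = y) (hg : ∀ x, g x = z)
    (ϕ : N → E →L[ℝ] E') (x₀ x : N) :
    inTangentCoordinates 𝓘(ℝ, E) 𝓘(ℝ, E') f g ϕ x₀ x = ϕ x := by
  obtain rfl : f = fun _ => y := funext hf
  obtain rfl : g = fun _ => z := funext hg
  refine (inTangentCoordinates_eq (I := 𝓘(ℝ, E)) (I' := 𝓘(ℝ, E')) (fun _ => y) (fun _ => z) ϕ
    (x₀ := x₀) (x := x) (mem_chart_source _ _) (mem_chart_source _ _)).trans ?_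
  refine ContinuousLinearMap.ext fun v => ?_
  simp only [ContinuousLinearMap.comp_apply]
  rw [(tangentBundleCore 𝓘(ℝ, E) G).coordChange_self _ _ (mem_chart_source _ _),
    (tangentBundleCore 𝓘(ℝ, E') M).coordChange_self _ _ (mem_chart_source _ _)]

theorem inTangentCoordinates_vectorSpace [IsManifold 𝓘(ℝ, E) 1 G]
    {F : Type*} [NormedAddCommGroup F] [NormedSpace ℝ F] {N : Type*} {f : N → G} {y : G}
    (hf : ∀ x, f x = y) (g : N → F) (ϕ : N → E →L[ℝ] F) (x₀ x : N) :
    inTangentCoordinates 𝓘(ℝ, E) 𝓘(ℝ, F) f g ϕ x₀ x = ϕ x := by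
  obtain rfl : f = fun _ => y := funext hf
  refine (inTangentCoordinates_eq (I := 𝓘(ℝ, E)) (I' := 𝓘(ℝ, F)) (fun _ => y) g ϕ
    (x₀ := x₀) (x := x) (mem_chart_source _ _) (Set.mem_univ _)).trans ?_
  refine ContinuousLinearMap.ext fun v => ?_
  simp only [ContinuousLinearMap.comp_apply]
  rw [(tangentBundleCore 𝓘(ℝ, E) G).coordChange_self _ _ (mem_chart_source _ _)]
  simp

theorem contMDiff_mfderiv_apply [IsManifold 𝓘(ℝ, E) ∞ G]
    {F : Type*} [NormedAddCommGroup F] [NormedSpace ℝ F] {f : G → G → F}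
    (hf : ContMDiff (𝓘(ℝ, E).prod 𝓘(ℝ, E)) 𝓘(ℝ, F) ∞ (Function.uncurry f)) (y : G) (v : E) :
    ContMDiff 𝓘(ℝ, E) 𝓘(ℝ, F) ∞
      (fun x : G => (mfderiv 𝓘(ℝ, E) 𝓘(ℝ, F) (f x) y v : F)) := by
  have : IsManifold 𝓘(ℝ, E) 1 G := IsManifold.of_le (n := ∞) (by norm_cast)
  intro x₀
  have h := ContMDiffAt.mfderiv_apply (n := ∞) (m := ∞) f (fun _ => y) id (fun _ => v)
    (hf (x₀, y)) contMDiffAt_const contMDiffAt_id contMDiffAt_const le_rfl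
  exact h.congr_of_eventuallyEq (Filter.Eventually.of_forall fun x =>
    congrArg (fun L : E →L[ℝ] F => L v)
      (inTangentCoordinates_vectorSpace (E := E) (F := F) (y := y) (fun _ => rfl) (fun x => f x y)
        (fun x => mfderiv 𝓘(ℝ, E) 𝓘(ℝ, F) (f x) y) x₀ x).symm)

variable [Group G]

theorem coad_hasFDerivAt (g : G) (ν : LieDual E) :
    HasFDerivAt (fun ν : LieDual E => coad g ν)
      ((ContinuousLinearMap.compL ℝ E E ℝ).flip (Ad g⁻¹)) ν :=
  ContinuousLinearMap.hasFDerivAt ((ContinuousLinearMap.compL ℝ E E ℝ).flip (Ad g⁻¹))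

variable [LieGroup 𝓘(ℝ, E) ∞ G]

/-- Every conjugation fixes 1, so its derivative there has both base points constant. -/
theorem contMDiff_Ad : ContMDiff 𝓘(ℝ, E) 𝓘(ℝ, E →L[ℝ] E) ∞ (fun g : G => Ad (E := E) g) := by
  have : IsManifold 𝓘(ℝ, E) 1 G := IsManifold.of_le (n := ∞) (by norm_cast)
  intro x₀
  have hf : ContMDiff (𝓘(ℝ, E).prod 𝓘(ℝ, E)) 𝓘(ℝ, E) ∞
      (Function.uncurry fun g x : G => g * x * g⁻¹) :=
    (contMDiff_fst.mul contMDiff_snd).mul contMDiff_fst.inv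
  have h := ContMDiffAt.mfderiv (n := ∞) (m := ∞) _ (fun _ => (1 : G)) (hf (x₀, 1))
    contMDiffAt_const le_rfl
  exact h.congr_of_eventuallyEq (Filter.Eventually.of_forall fun x =>
    (inTangentCoordinates_of_forall_eq (y := (1 : G)) (z := (1 : G)) (fun _ => rfl)
      (fun x => by simp) _ x₀ x).symm)

theorem contMDiff_coad (η : LieDual E) :
    ContMDiff 𝓘(ℝ, E) 𝓘(ℝ, LieDual E) ∞ (fun g : G => coad g η) :=
  (ContinuousLinearMap.contDiff ((ContinuousLinearMap.compL ℝ E E ℝ) η)).contMDiff.comp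
    (contMDiff_Ad.comp contMDiff_id.inv)

theorem mdifferentiable_coad (η : LieDual E) :
    MDifferentiable 𝓘(ℝ, E) 𝓘(ℝ, LieDual E) (fun g : G => coad g η) :=
  (contMDiff_coad η).mdifferentiable (by simp)

/-- The tangent vector to `G` at `g` obtained by right translation of `A`. -/
def rightTranslate (A : LieAlg E G) (g : G) : TangentSpace 𝓘(ℝ, E) g :=
  (mfderiv 𝓘(ℝ, E) 𝓘(ℝ, E) (fun b : G => b * g) 1 A : E)

theorem mfderiv_eq_rightTranslate {F : Type*} [NormedAddCommGroup F] [NormedSpace ℝ F]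
    {f : G → F} {g : G} (hf : MDifferentiableAt 𝓘(ℝ, E) 𝓘(ℝ, F) f g) (A : LieAlg E G) :
    (mfderiv 𝓘(ℝ, E) 𝓘(ℝ, F) (fun b : G => f (b * g)) 1 A : F)
      = mfderiv 𝓘(ℝ, E) 𝓘(ℝ, F) f g (rightTranslate A g) :=
  mfderiv_comp_apply_of_eq (x := (1 : G)) (y := g) hf
    (mdifferentiable_mul_right (E := E) g 1) (one_mul g) A

theorem mfderiv_coad_rightTranslate (η : LieDual E) (A : LieAlg E G) (g : G) :
    (mfderiv 𝓘(ℝ, E) 𝓘(ℝ, LieDual E) (fun x : G => coad x η) g (rightTranslate A g) : LieDual E)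
      = fundamentalField A (coad g η) := by
  have h := mfderiv_eq_rightTranslate (mdifferentiable_coad η g) A
  have e : (fun b : G => coad (b * g) η) = fun b => coad b (coad g η) :=
    funext fun b => coad_mul b g η
  rw [e] at h
  exact h.symm

/-- Translating A·g back to 1 by g⁻¹ gives Ad_{g⁻¹} A. -/
theorem leftInvariantForm_rightTranslate (η : LieDual E) (A : LieAlg E G) (g : G) :
    leftInvariantForm η g (rightTranslate A g) = coad g η A := by
  have e : (fun b : G => g⁻¹ * b * g⁻¹⁻¹) = (fun x => g⁻¹ * x) ∘ (fun b => b * g) := by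
    ext b; simp [mul_assoc]
  have h := mfderiv_comp_apply_of_eq (I := 𝓘(ℝ, E)) (I' := 𝓘(ℝ, E)) (I'' := 𝓘(ℝ, E))
    (x := (1 : G)) (y := g) (mdifferentiable_mul_left (E := E) g⁻¹ g)
    (mdifferentiable_mul_right (E := E) g 1) (one_mul g) A
  rw [← e] at h
  exact (congrArg η h).symm

theorem mfderiv_mul_left_inv (g : G) (v : TangentSpace 𝓘(ℝ, E) g) :
    (mfderiv 𝓘(ℝ, E) 𝓘(ℝ, E) (fun x : G => g * x) 1
      (mfderiv 𝓘(ℝ, E) 𝓘(ℝ, E) (fun x : G => g⁻¹ * x) g v : E) : E) = v := by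
  have e : (fun x : G => g * x) ∘ (fun x => g⁻¹ * x) = id := by ext x; simp
  have h := mfderiv_comp_apply_of_eq (I := 𝓘(ℝ, E)) (I' := 𝓘(ℝ, E)) (I'' := 𝓘(ℝ, E))
    (x := g) (y := (1 : G)) (mdifferentiable_mul_left (E := E) g 1)
    (mdifferentiable_mul_left (E := E) g⁻¹ g) (inv_mul_cancel g) v
  rw [e, mfderiv_id] at h
  exact h.symm

/-- By the group law, a zero derivative of the orbit curve at time 0 propagates to all times, so the
curve t ↦ γ(t)·η is constant. -/
theorem oneParameterSubgroup_mem_isotropy {η : LieDual E} {g : G} {γ : ℝ → G}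
    (hmul : ∀ t u, γ (t + u) = γ t * γ u)
    (h : HasDerivAt (fun t => coad (g * γ t) η) 0 0) (t : ℝ) : γ t ∈ isotropy G η := by
  have h0 : γ 0 = 1 := by simpa using hmul 0 0
  have hd : ∀ t, HasDerivAt (fun r => coad (γ r) η) 0 t := by
    intro t
    -- Acting by γ(t)g⁻¹ undoes g and shifts time from 0 to t.
    have h1 := (coad_hasFDerivAt (γ t * g⁻¹) _).comp_hasDerivAt (0 : ℝ) h
    rw [map_zero] at h1
    have h2 : HasDerivAt (fun u => coad (γ (t + u)) η) 0 (0 : ℝ) := by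
      refine h1.congr_of_eventuallyEq (Filter.Eventually.of_forall fun u => ?_)
      simp only [Function.comp_apply]
      rw [← coad_mul, hmul]
      congr 1
      group
    have h3 := HasDerivAt.comp_sub_const t t (by rwa [sub_self])
    simpa using h3
  have hc := is_const_of_deriv_eq_zero (fun t => (hd t).differentiableAt) (fun t => (hd t).deriv) t 0
  change coad (γ t) η = η
  rw [hc, h0, coad_one]

section

variable [T2Space G] [CompleteSpace E]

/-- Along a one-parameter subgroup, inversion is t ↦ -t. -/
theorem mfderiv_comp_inv {F : Type*} [NormedAddCommGroup F] [NormedSpace ℝ F]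
    {f : G → F} (hf : MDifferentiableAt 𝓘(ℝ, E) 𝓘(ℝ, F) f 1) (A : LieAlg E G) :
    (mfderiv 𝓘(ℝ, E) 𝓘(ℝ, F) (fun b : G => f b⁻¹) 1 A : F)
      = -(mfderiv 𝓘(ℝ, E) 𝓘(ℝ, F) f 1 A : F) := by
  obtain ⟨γ, hmul, hγ, hA⟩ := exists_oneParameterSubgroup A
  have h0 : γ 0 = 1 := by simpa using hmul 0 0
  have hneg : ∀ t, γ (-t) = (γ t)⁻¹ := fun t =>
    eq_inv_of_mul_eq_one_left (by rw [← hmul, neg_add_cancel, h0])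
  have hd := hγ.mdifferentiable (by simp) 0
  have hinv : MDifferentiableAt 𝓘(ℝ, E) 𝓘(ℝ, E) (fun b : G => b⁻¹) 1 :=
    (contMDiff_inv 𝓘(ℝ, E) ∞).mdifferentiable (by simp) 1
  have h1 := hasDerivAt_comp_curve h0 hf hd hA
  have h2 := hasDerivAt_comp_curve h0
    (MDifferentiableAt.comp_of_eq (y := 1) (f := fun b : G => b⁻¹) (g := f) (x := 1) hf hinv
      inv_one) hd hA
  have h3 : HasDerivAt (fun t => f (γ (-t))) (-(mfderiv 𝓘(ℝ, E) 𝓘(ℝ, F) f 1 A : F)) 0 := by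
    have h := HasDerivAt.comp_const_sub (0 : ℝ) (0 : ℝ) (by simpa only [sub_zero] using h1)
    simp only [zero_sub] at h
    exact h
  simp only [hneg] at h3
  exact h2.unique h3

end

end Smoothness

/-! ### The covariant derivative and 𝒫 on equivariant functions. -/

section Prequantum

variable {E : Type*} [NormedAddCommGroup E] [NormedSpace ℝ E]
  {G : Type*} [TopologicalSpace G] [ChartedSpace E G] [Group G] [LieGroup 𝓘(ℝ, E) ∞ G]
  {η : LieDual E} {Λ : isotropy G η →* Circle}

/-- The differential `T_g G → ℂ` of a complex function on `G`. -/
def differential (s : G → ℂ) (g : G) : E →L[ℝ] ℂ := mfderiv 𝓘(ℝ, E) 𝓘(ℝ, ℂ) s g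

theorem equivariantFunction_mdifferentiable (s : EquivariantFunctions Λ) :
    MDifferentiable 𝓘(ℝ, E) 𝓘(ℝ, ℂ) (s : G → ℂ) :=
  s.2.1.mdifferentiable (by simp)

/-- An equivariant function is differentiated along the fibres of `G → 𝒪` by the differential of
the character. -/
theorem differential_of_tangent_fibre [T2Space G] [CompleteSpace E]
    (hΛ : HasDifferential η Λ) (s : EquivariantFunctions Λ) (g : G) (v : TangentSpace 𝓘(ℝ, E) g)
    (hv : (mfderiv 𝓘(ℝ, E) 𝓘(ℝ, LieDual E) (fun x : G => coad x η) g v : LieDual E) = 0) :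
    differential (E := E) s.1 g v = -(2 * Real.pi * Complex.I * leftInvariantForm η g v * s.1 g) := by
  -- The velocity g⁻¹v makes gγ(t) a curve through g with velocity v, and η of this velocity is θ(v)
  -- by definition.
  obtain ⟨γ, hmul, hγ, hC⟩ := exists_oneParameterSubgroup (E := E) (G := G)
    (mfderiv 𝓘(ℝ, E) 𝓘(ℝ, E) (fun x : G => g⁻¹ * x) g v : E)
  have h0 : γ 0 = 1 := by simpa using hmul 0 0
  have hd := hγ.mdifferentiable (by simp) 0
  have hcv : (mfderiv 𝓘(ℝ, ℝ) 𝓘(ℝ, E) (fun t => g * γ t) 0 (1 : ℝ) : E) = v := by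
    have h := mfderiv_comp_apply_of_eq (I := 𝓘(ℝ, ℝ)) (I' := 𝓘(ℝ, E)) (I'' := 𝓘(ℝ, E))
      (x := (0 : ℝ)) (y := (1 : G)) (mdifferentiable_mul_left (E := E) g 1) hd h0 (1 : ℝ)
    rw [hC] at h
    exact h.trans (mfderiv_mul_left_inv g v)
  have hc : MDifferentiableAt 𝓘(ℝ, ℝ) 𝓘(ℝ, E) (fun t => g * γ t) 0 :=
    (mdifferentiable_mul_left (E := E) g (γ 0)).comp 0 hd
  have hc0 : g * γ 0 = g := by rw [h0, mul_one]
  have h1 := hasDerivAt_comp_curve hc0 (mdifferentiable_coad η g) hc hcv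
  rw [hv] at h1
  have hmem := oneParameterSubgroup_mem_isotropy hmul h1
  have h2 := hasDerivAt_comp_curve hc0 (equivariantFunction_mdifferentiable s g) hc hcv
  have h3 := hΛ γ hmem _ hmul hγ hC
  have hneg : ∀ t, (γ (-t))⁻¹ = γ t := fun t =>
    inv_eq_of_mul_eq_one_right (by rw [← hmul, neg_add_cancel, h0])
  -- Equivariance with b = γ(-t) reads s(gγ(t)) = Λ(γ(-t)) s(g); the reversed time produces the
  -- minus sign.
  have h4 : HasDerivAt (fun t : ℝ => (Λ ⟨γ (-t), hmem (-t)⟩ : ℂ) * s.1 g)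
      (-(2 * Real.pi * Complex.I * leftInvariantForm η g v * s.1 g)) 0 := by
    have h5 := (HasDerivAt.comp_const_sub (0 : ℝ) 0 (by rwa [sub_zero])).mul_const (s.1 g)
    simp only [zero_sub, neg_mul] at h5
    exact h5
  refine h2.unique (h4.congr_of_eventuallyEq (Filter.Eventually.of_forall fun t => ?_))
  have := s.2.2 g ⟨γ (-t), hmem (-t)⟩
  rwa [hneg] at this

/-- The quotient rule for s(g)/z, with z varying as well. -/
theorem sharpDeriv_eq (σ : AllSections Λ) (g : G) {z : ℂ} (hz : z ≠ 0)
    (hσ : MDifferentiableAt 𝓘(ℝ, E) 𝓘(ℝ, ℂ) (funOfSection Λ σ) g)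
    (v : TangentSpace 𝓘(ℝ, E) g) (ζ : ℂ) :
    sharpDeriv Λ σ g z v ζ
      = differential (E := E) (funOfSection Λ σ) g v / z
        - funOfSection Λ σ g * ζ / z ^ 2 := by
  have hinv : HasFDerivAt (fun w : ℂ => w⁻¹)
      ((ContinuousLinearMap.toSpanSingleton ℂ (-(z ^ 2)⁻¹)).restrictScalars ℝ) z :=
    (hasDerivAt_inv hz).hasFDerivAt.restrictScalars ℝ
  have h1 : HasMFDerivAt (𝓘(ℝ, E).prod 𝓘(ℝ, ℂ)) 𝓘(ℝ, ℂ)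
      (fun p : G × ℂ => funOfSection Λ σ p.1) (g, z) _ :=
    hσ.hasMFDerivAt.comp (g, z) (hasMFDerivAt_fst (g, z))
  have h2 : HasMFDerivAt (𝓘(ℝ, E).prod 𝓘(ℝ, ℂ)) 𝓘(ℝ, ℂ)
      (fun p : G × ℂ => p.2⁻¹) (g, z) _ :=
    hinv.hasMFDerivAt.comp (g, z) (hasMFDerivAt_snd (g, z))
  have h3 := (h1.mul h2).mfderiv
  have e : sharp Λ σ = (fun p : G × ℂ => funOfSection Λ σ p.1) * (fun p : G × ℂ => p.2⁻¹) := by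
    ext p
    exact div_eq_mul_inv _ _
  unfold sharpDeriv
  rw [e, h3]
  change funOfSection Λ σ g * (ζ * -(z ^ 2)⁻¹)
    + z⁻¹ * differential (E := E) (funOfSection Λ σ) g v = _
  ring

/-- An equivariant function defines a section: the classes [g, u(g)] agree over one point of the
orbit. -/
theorem frame_mul_inv {ν : Orbit G η} (g g' : G) (hg : orbitMap η g = ν)
    (hg' : orbitMap η g' = ν) {u : G → ℂ}
    (hu : ∀ (g : G) (b : isotropy G η), u (g * (b : G)⁻¹) = (Λ b : ℂ) * u g) :
    frame Λ g hg (u g) = frame Λ g' hg' (u g') := by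
  have e : coad g η = coad g' η := congrArg Subtype.val (hg.trans hg'.symm)
  have hb : g'⁻¹ * g ∈ isotropy G η := by
    change coad (g'⁻¹ * g) η = η
    rw [coad_mul, e, ← coad_mul, inv_mul_cancel, coad_one]
  have h := cls_mul_inv Λ g ⟨_, hb⟩ (u g)
  rw [← hu] at h
  apply Subtype.ext
  refine h.symm.trans ?_
  simp only [mul_inv_rev, inv_inv, mul_inv_cancel_left]
  rfl

/-- The infinitesimal left translation `A · s`. -/
def infinitesimalTranslation (s : G → ℂ) (A : LieAlg E G) (g : G) : ℂ :=
  mfderiv 𝓘(ℝ, E) 𝓘(ℝ, ℂ) (fun b : G => s (b⁻¹ * g)) 1 A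

theorem contMDiff_translate {s : G → ℂ} (hs : ContMDiff 𝓘(ℝ, E) 𝓘(ℝ, ℂ) ∞ s) :
    ContMDiff (𝓘(ℝ, E).prod 𝓘(ℝ, E)) 𝓘(ℝ, ℂ) ∞ (fun p : G × G => s (p.1⁻¹ * p.2)) :=
  hs.comp (contMDiff_fst.inv.mul contMDiff_snd)

/-- Left and right translations commute, so equivariance survives differentiation; smoothness in g
is that of a derivative depending on a parameter. -/
theorem infinitesimalTranslation_mem (s : EquivariantFunctions Λ) (A : LieAlg E G) :
    infinitesimalTranslation s.1 A ∈ EquivariantFunctions Λ := by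
  refine ⟨contMDiff_mfderiv_apply (f := fun g b : G => s.1 (b⁻¹ * g))
    (s.2.1.comp (contMDiff_snd.inv.mul contMDiff_fst)) 1 A, fun g b => ?_⟩
  have hd : MDifferentiableAt 𝓘(ℝ, E) 𝓘(ℝ, ℂ) (fun c : G => s.1 (c⁻¹ * g)) 1 :=
    (s.2.1.comp (contMDiff_id.inv.mul contMDiff_const)).mdifferentiable (by simp) 1
  have e : (fun c : G => s.1 (c⁻¹ * (g * (b : G)⁻¹)))
      = fun c => ContinuousLinearMap.mul ℝ ℂ (Λ b : ℂ) (s.1 (c⁻¹ * g)) := by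
    ext c
    rw [← mul_assoc, s.2.2]
    rfl
  have h := (((ContinuousLinearMap.mul ℝ ℂ (Λ b : ℂ)).hasFDerivAt.hasMFDerivAt.comp (1 : G)
    hd.hasMFDerivAt)).mfderiv
  unfold infinitesimalTranslation
  rw [e]
  exact congrArg (fun L : E →L[ℝ] ℂ => L A) h

theorem exists_isCovariantDerivative (σ : AllSections Λ) (A : LieAlg E G) (g : G) :
    ∃ w, IsCovariantDerivative Λ σ (orbitMap η g) (fundamentalField A (coad g η)) w := by
  -- At z = 1 the vertical component is the unique one killed by the connection form.
  refine ⟨_, g, rfl, 1, rightTranslate A g,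
    -(2 * Real.pi * Complex.I * (leftInvariantForm η g (rightTranslate A g) : ℂ)), one_ne_zero,
    ⟨mfderiv_coad_rightTranslate η A g, ?_⟩, rfl⟩
  have hpi : (2 * Real.pi * Complex.I : ℂ) ≠ 0 := Complex.two_pi_I_ne_zero
  unfold connectionForm
  field_simp
  ring

section

variable [T2Space G] [CompleteSpace E]

theorem differential_rightTranslate (s : EquivariantFunctions Λ) (A : LieAlg E G) (g : G) :
    differential (E := E) s.1 g (rightTranslate A g) = -infinitesimalTranslation s.1 A g := by
  have hd : MDifferentiableAt 𝓘(ℝ, E) 𝓘(ℝ, ℂ) (fun b : G => s.1 (b * g)) 1 :=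
    (s.2.1.comp (contMDiff_id.mul contMDiff_const)).mdifferentiable (by simp) 1
  have h := mfderiv_comp_inv hd A
  rw [mfderiv_eq_rightTranslate (equivariantFunction_mdifferentiable s g) A] at h
  exact (neg_eq_iff_eq_neg.2 h).symm

/-- The covariant derivative along `X_A` does not depend on the horizontal lift chosen. -/
theorem isCovariantDerivative_eq (hΛ : HasDifferential η Λ) (σ : SmoothSections Λ)
    (A : LieAlg E G) (g : G) {w : Fiber Λ (orbitMap η g)}
    (hw : IsCovariantDerivative Λ σ.1 (orbitMap η g) (fundamentalField A (coad g η)) w) :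
    w = frame Λ g rfl (-infinitesimalTranslation (funOfSection Λ σ.1) A g
      + 2 * Real.pi * Complex.I * (coad g η A : ℝ) * funOfSection Λ σ.1 g) := by
  obtain ⟨g', hg', z, v, ζ, hz, ⟨hv, hΩ⟩, rfl⟩ := hw
  set s : EquivariantFunctions Λ := sectionEquiv Λ σ
  have e : coad g' η = coad g η := congrArg Subtype.val hg'
  have hker : (mfderiv 𝓘(ℝ, E) 𝓘(ℝ, LieDual E) (fun x : G => coad x η) g'
      (v - rightTranslate A g') : LieDual E) = 0 := by
    refine (map_sub _ _ _).trans (sub_eq_zero.2 (hv.trans ?_))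
    rw [← e]
    exact (mfderiv_coad_rightTranslate η A g').symm
  have h1 := differential_of_tangent_fibre hΛ s g' _ hker
  have h2 : differential (E := E) s.1 g' (v - rightTranslate A g')
      = differential (E := E) s.1 g' v - differential (E := E) s.1 g' (rightTranslate A g') :=
    map_sub _ _ _
  have h3 : leftInvariantForm η g' (v - rightTranslate A g')
      = leftInvariantForm η g' v - coad g' η A := by
    rw [← leftInvariantForm_rightTranslate]
    exact (congrArg η (map_sub _ _ _)).trans (map_sub η _ _)
  have h4 := differential_rightTranslate s A g'
  have h5 := sharpDeriv_eq σ.1 g' hz (equivariantFunction_mdifferentiable s g') v ζ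
  rw [← frame_smul]
  -- The factor z cancels the denominators. The θ(v) terms from `hd` and from `hζ` are opposite, so
  -- no trace of the chosen lift v remains.
  have hval : sharpDeriv Λ σ.1 g' z v ζ * z = -infinitesimalTranslation s.1 A g'
      + 2 * Real.pi * Complex.I * (coad g η A : ℝ) * s.1 g' := by
    have hd : differential (E := E) (funOfSection Λ σ.1) g' v
        = -(2 * Real.pi * Complex.I
            * ((leftInvariantForm η g' v - coad g' η A : ℝ) : ℂ) * s.1 g')
          - infinitesimalTranslation s.1 A g' := by
      rw [h2, h4, h3, sub_neg_eq_add] at h1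
      exact eq_sub_of_add_eq h1
    have hζ : ζ = -(2 * Real.pi * Complex.I * (leftInvariantForm η g' v : ℂ) * z) := by
      have hpi : (2 * Real.pi * Complex.I : ℂ) ≠ 0 := Complex.two_pi_I_ne_zero
      unfold connectionForm at hΩ
      field_simp at hΩ
      linear_combination hΩ
    have hs' : s.1 g' = funOfSection Λ σ.1 g' := rfl
    rw [h5, hd, hζ, hs', ← e]
    push_cast
    field_simp
    ring
  rw [hval]
  -- Both terms are equivariant in g', because the coefficient (g·η)(A) is held fixed; this carries
  -- the value from g' to g.
  refine frame_mul_inv g' g hg' rfl (u := fun g' => -infinitesimalTranslation s.1 A g'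
    + 2 * Real.pi * Complex.I * (coad g η A : ℝ) * s.1 g') fun x b => ?_
  simp only [(infinitesimalTranslation_mem s A).2 x b, s.2.2 x b]
  ring

theorem funOfSection_prequantumOp (hΛ : HasDifferential η Λ) (σ : SmoothSections Λ)
    (A : LieAlg E G) :
    funOfSection Λ (prequantumOp Λ A σ.1)
      = infinitesimalTranslation (funOfSection Λ σ.1) A := by
  ext g
  have h1 := isCovariantDerivative_eq hΛ σ A g
    (Classical.epsilon_spec (exists_isCovariantDerivative σ.1 A g))
  refine (frameₗ Λ g rfl).symm_apply_eq.2 ?_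
  have h2 : σ.1 (orbitMap η g) = frameₗ Λ g rfl (funOfSection Λ σ.1 g) :=
    ((frameₗ Λ g rfl).apply_symm_apply _).symm
  have h3 : covariantDerivative Λ σ.1 (orbitMap η g) (fundamentalField A (orbitMap η g).1)
      = frameₗ Λ g rfl (-infinitesimalTranslation (funOfSection Λ σ.1) A g
      + 2 * Real.pi * Complex.I * (coad g η A : ℝ) * funOfSection Λ σ.1 g) := h1
  unfold prequantumOp
  rw [h2, h3, ← map_neg, ← map_smul, ← map_sub]
  -- What remains is the cancellation of 2πi (g·η)(A) s against the Hamiltonian term.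
  congr 1
  have h4 : hamiltonian A (orbitMap η g) = -(coad g η A) := rfl
  rw [h4, smul_eq_mul]
  push_cast
  ring

theorem prequantumOpFun_eq (hΛ : HasDifferential η Λ) (s : EquivariantFunctions Λ)
    (A : LieAlg E G) : prequantumOpFun Λ A s = infinitesimalTranslation s.1 A := by
  have h : funOfSection Λ ((sectionEquiv Λ).symm s).1 = s.1 :=
    congrArg Subtype.val ((sectionEquiv Λ).apply_symm_apply s)
  have h1 := funOfSection_prequantumOp hΛ ((sectionEquiv Λ).symm s) A
  rw [h] at h1
  exact h1

end

variable (Λ) in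
/-- The action of `G` on `C^∞(L)` that corresponds to left translation on `ℰ_Λ`. -/
def sectionTranslation : Representation ℂ G (SmoothSections Λ) :=
  ((sectionEquiv Λ).symm.conjAlgEquiv ℂ : _ →* _).comp (leftTranslation Λ)

theorem funOfSection_sectionTranslation (b : G) (σ : SmoothSections Λ) (g : G) :
    funOfSection Λ (sectionTranslation Λ b σ).1 g = funOfSection Λ σ.1 (b⁻¹ * g) :=
  congrFun (congrArg Subtype.val
    ((sectionEquiv Λ).apply_symm_apply (leftTranslation Λ b (sectionEquiv Λ σ)))) g

theorem generates_sectionTranslation [T2Space G] [CompleteSpace E] (hΛ : HasDifferential η Λ) :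
    Generates Λ (sectionTranslation Λ) := by
  intro σ
  simp only [funOfSection_prequantumOp hΛ, funOfSection_sectionTranslation]
  refine ⟨contMDiff_translate σ.2, fun A g => ?_⟩
  exact congrArg (fun f : G → ℂ => differential (E := E) f 1 A)
    (funext fun b => funOfSection_sectionTranslation b σ g)

end Prequantum

end CoadjointOrbit
end

open CoadjointOrbit in
theorem mainTheorem6 {E : Type*} [NormedAddCommGroup E] [NormedSpace ℝ E] [FiniteDimensional ℝ E]
    {G : Type*} [TopologicalSpace G] [ChartedSpace E G] [Group G] [LieGroup 𝓘(ℝ, E) ∞ G]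
    [CompactSpace G] [T2Space G]
    (η : LieDual E) (Λ : isotropy G η →* Circle) (hΛ_cont : Continuous Λ)
    (hΛ : HasDifferential η Λ) :
    (∀ s : EquivariantFunctions Λ,
      (∀ A : LieAlg E G, prequantumOpFun Λ A s ∈ EquivariantFunctions Λ) ∧
      ContMDiff (𝓘(ℝ, E).prod 𝓘(ℝ, E)) 𝓘(ℝ, ℂ) ∞
        (fun p : G × G => (leftTranslation Λ p.1 s : G → ℂ) p.2) ∧
      ∀ (A : LieAlg E G) (g : G),
        (mfderiv 𝓘(ℝ, E) 𝓘(ℝ, ℂ) (fun b : G => (leftTranslation Λ b s : G → ℂ) g) 1 A : ℂ)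
          = prequantumOpFun Λ A s g) ∧
    IsGInvariant Λ := by
  have : CompleteSpace E := FiniteDimensional.complete ℝ E
  refine ⟨fun s => ⟨fun A => ?_, contMDiff_translate s.2.1, fun A g => ?_⟩,
    sectionTranslation Λ, generates_sectionTranslation hΛ⟩
  · rw [prequantumOpFun_eq hΛ]
    exact infinitesimalTranslation_mem s A
  · rw [prequantumOpFun_eq hΛ]
    rfl
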